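/- Let $d,m\ge 1$, $0<r<1$, and let $S_i(x)=rR_ix+t_i$ $(i=1,\dots,m)$ be similitudes of $\mathbb R^d$ with $R_i$ orthogonal and $t_i\in\mathbb R^d$. Let $K$ be the associated self-similar set, i.e. the unique nonempty compact set with $K=\bigcup_{i=1}^m S_i(K)$, and let $J\subset\mathbb R^d$ be any nonempty bounded closed set with $S_i(J)\subset J$ for all $i$ (for example $J=K$). Let $\Sigma=\{1,\dots,m\}$ and $X=\bigcup_{n\ge 0}\Sigma^n$, and for $\mathbf u=i_1\cdots i_n$ put $S_{\mathbf u}=S_{i_1}\circ\cdots\circ S_{i_n}$. The augmented tree is the graph on $X$ whose vertical edges join each word $\mathbf u$ to $\mathbf ui$ $(i\in\Sigma)$, and whose horizontal edges join any two distinct words $\mathbf u,\mathbf v$ of the same length with $S_{\mathbf u}(J)\cap S_{\mathbf v}(J)\neq\emptyset$. A horizontal connected component is a maximal subset of some level $\Sigma^n$ that is connected by horizontal edges. (i) If there is $N\in\mathbb N$ such that every horizontal connected component (on every level) has at most $N$ elements, then $K$ is totally disconnected. (ii) Conversely, if $d=1$, the system satisfies the open set condition (there is a nonempty bounded open set $U$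 such that the sets $S_i(U)$ are pairwise disjoint and contained in $U$), and $K$ is totally disconnected, then there is $N\in\mathbb N$ such that every horizontal connected component has at most $N$ elements. -/

import Mathlib

/-- A finite family of contractive similitudes `S i x = r • R i x + t i` on `ℝ^d`
with one common ratio `0 < r < 1`; the `R i` are orthogonal (linear isometries of `ℝ^d`). -/
structure SimilarIFS (d m : ℕ) where
  ratio : ℝ
  ratio_pos : 0 < ratio
  ratio_lt_one : ratio < 1
  rot : Fin m → (EuclideanSpace ℝ (Fin d) ≃ₗᵢ[ℝ] EuclideanSpace ℝ (Fin d))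
  shift : Fin m → EuclideanSpace ℝ (Fin d)

namespace SimilarIFS

/-- The similitude `S i`. -/
noncomputable def map {d m : ℕ} (F : SimilarIFS d m) (i : Fin m) (x : EuclideanSpace ℝ (Fin d)) :
    EuclideanSpace ℝ (Fin d) :=
  F.ratio • F.rot i x + F.shift i

/-- For a word `u = [i₁, …, iₙ]`, the composition `S i₁ ∘ ⋯ ∘ S iₙ`
(the identity for the empty word). -/
noncomputable def wordMap {d m : ℕ} (F : SimilarIFS d m) :
    List (Fin m) → EuclideanSpace ℝ (Fin d) → EuclideanSpace ℝ (Fin d)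
  | [] => id
  | i :: u => F.map i ∘ F.wordMap u

/-- `K` is the self-similar set of the family: the (unique) nonempty compact set with
`K = ⋃ i, S i (K)`. -/
def IsSelfSimilarSet {d m : ℕ} (F : SimilarIFS d m) (K : Set (EuclideanSpace ℝ (Fin d))) : Prop :=
  K.Nonempty ∧ IsCompact K ∧ K = ⋃ i, F.map i '' K

/-- `J` is a nonempty bounded closed set with `S i (J) ⊆ J` for every `i`. -/
def IsInvariantSet {d m : ℕ} (F : SimilarIFS d m) (J : Set (EuclideanSpace ℝ (Fin d))) : Prop :=
  J.Nonempty ∧ IsClosed J ∧ Bornology.IsBounded J ∧ ∀ i, F.map i '' J ⊆ J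

/-- The open set condition. -/
def OpenSetCondition {d m : ℕ} (F : SimilarIFS d m) : Prop :=
  ∃ U : Set (EuclideanSpace ℝ (Fin d)), U.Nonempty ∧ IsOpen U ∧ Bornology.IsBounded U ∧
    (∀ i, F.map i '' U ⊆ U) ∧ Pairwise fun i j => Disjoint (F.map i '' U) (F.map j '' U)

/-- The vertical edges: the tree of all finite words rooted at the empty word, in which each
nonempty word `v ++ [i]` is joined to its parent `v`. -/
def verticalGraph (m : ℕ) : SimpleGraph (List (Fin m)) where
  Adj u v := (∃ i, v = u ++ [i]) ∨ (∃ i, u = v ++ [i])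
  symm := ⟨fun _ _ h => h.symm⟩
  loopless := ⟨fun u h => by rcases h with ⟨i, h⟩ | ⟨i, h⟩ <;> simp at h⟩

/-- The horizontal edges defined by `J`: distinct words `u`, `v` of the same length are joined
when `S_u(J)` and `S_v(J)` meet. -/
def horizontalGraph {d m : ℕ} (F : SimilarIFS d m) (J : Set (EuclideanSpace ℝ (Fin d))) :
    SimpleGraph (List (Fin m)) where
  Adj u v := u.length = v.length ∧ u ≠ v ∧ (F.wordMap u '' J ∩ F.wordMap v '' J).Nonempty
  symm := ⟨fun _ _ h => ⟨h.1.symm, h.2.1.symm, Set.inter_comm _ _ ▸ h.2.2⟩⟩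
  loopless := ⟨fun _ h => h.2.1 rfl⟩

/-- The augmented tree: all vertical and horizontal edges. -/
def augmentedTree {d m : ℕ} (F : SimilarIFS d m) (J : Set (EuclideanSpace ℝ (Fin d))) :
    SimpleGraph (List (Fin m)) :=
  verticalGraph m ⊔ F.horizontalGraph J

/-- The horizontal part of a graph on words: its edges between words of the same length. -/
def horizontalPart {m : ℕ} (G : SimpleGraph (List (Fin m))) : SimpleGraph (List (Fin m)) where
  Adj u v := G.Adj u v ∧ u.length = v.length
  symm := ⟨fun _ _ h => ⟨h.1.symm, h.2.symm⟩⟩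
  loopless := ⟨fun u h => G.loopless.irrefl u h.1⟩

/-- The horizontal edges of the augmented tree are exactly those defined by `J`. -/
theorem horizontalPart_augmentedTree {d m : ℕ} (F : SimilarIFS d m)
    (J : Set (EuclideanSpace ℝ (Fin d))) :
    horizontalPart (F.augmentedTree J) = F.horizontalGraph J := by
  ext u v
  constructor
  · rintro ⟨(⟨i, h⟩ | ⟨i, h⟩) | h, hl⟩
    · simp [h] at hl
    · simp [h] at hl
    · exact h
  · intro h
    exact ⟨Or.inr h, h.1⟩

/-- The horizontal connected components of the augmented tree defined by `J` have uniformly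
bounded (finite) cardinality. Such a component automatically lies in one level, since horizontal
edges join words of the same length. -/
def BoundedHorizontalComponents {d m : ℕ} (F : SimilarIFS d m)
    (J : Set (EuclideanSpace ℝ (Fin d))) : Prop :=
  ∃ N : ℕ, ∀ C : (horizontalPart (F.augmentedTree J)).ConnectedComponent, C.supp.encard ≤ N

end SimilarIFS

namespace SimilarIFS

open Metric

variable {d m : ℕ} (F : SimilarIFS d m)

/-! For (i), split the level-`n` cells `S_u(K)` into those in one horizontal component and the rest.
The two unions are closed and disjoint, so a connected part of `K` stays in one cluster. At most `N`
cells form a cluster, so its diameter is `O(r ^ n)`, which tends to 0.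

For (ii), the open set condition bounds the number of level-`j` cells near a ball of radius `r ^ j`.
Removing these nowhere dense cells one at a time leaves a hole of radius `δ * r ^ j` with `δ`
independent of `j` (`OpenSetCondition.exists_hole`). On the line, a chain whose steps are shorter
than a hole cannot jump over it (`coord_lt_of_reachable`), so a level-`n` component has diameter
`O(r ^ n)`. The same counting then bounds its cardinality. -/

theorem dist_wordMap (u : List (Fin m)) (x y : EuclideanSpace ℝ (Fin d)) :
    dist (F.wordMap u x) (F.wordMap u y) = F.ratio ^ u.length * dist x y := by
  induction u with
  | nil => simp [wordMap]
  | cons i u ih =>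
    simp only [wordMap, Function.comp, map, dist_add_right, dist_smul₀, LinearIsometryEquiv.dist_map,
      ih, Real.norm_eq_abs, abs_of_pos F.ratio_pos, List.length_cons]
    ring

theorem wordMap_surjective (u : List (Fin m)) : Function.Surjective (F.wordMap u) := by
  induction u with
  | nil => exact Function.surjective_id
  | cons i u ih =>
    refine Function.Surjective.comp (fun y => ?_) ih
    refine ⟨(F.rot i).symm (F.ratio⁻¹ • (y - F.shift i)), ?_⟩
    simp [map, smul_smul, mul_inv_cancel₀ F.ratio_pos.ne']

theorem continuous_wordMap (u : List (Fin m)) : Continuous (F.wordMap u) :=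
  (LipschitzWith.of_dist_le_mul (K := ⟨F.ratio ^ u.length, pow_nonneg F.ratio_pos.le _⟩)
    fun x y => (F.dist_wordMap u x y).le).continuous

theorem ball_wordMap_subset {u : List (Fin m)} {x y : EuclideanSpace ℝ (Fin d)} {δ ρ : ℝ}
    (h : ball x δ ⊆ ball y ρ) :
    ball (F.wordMap u x) (δ * F.ratio ^ u.length) ⊆
      ball (F.wordMap u y) (ρ * F.ratio ^ u.length) := by
  intro z hz
  obtain ⟨z, rfl⟩ := F.wordMap_surjective u z
  have hp := pow_pos F.ratio_pos u.length
  rw [mem_ball, dist_wordMap, mul_comm, mul_lt_mul_iff_left₀ hp] at hz ⊢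
  exact h hz

variable {F}

theorem wordMap_mem {A : Set (EuclideanSpace ℝ (Fin d))} (hA : ∀ i, F.map i '' A ⊆ A)
    (u : List (Fin m)) {x : EuclideanSpace ℝ (Fin d)} (hx : x ∈ A) : F.wordMap u x ∈ A := by
  induction u with
  | nil => exact hx
  | cons i u ih => exact hA i ⟨_, ih, rfl⟩

namespace IsSelfSimilarSet

variable {K : Set (EuclideanSpace ℝ (Fin d))}

theorem map_subset (hK : F.IsSelfSimilarSet K) (i : Fin m) : F.map i '' K ⊆ K := by
  conv_rhs => rw [hK.2.2]
  exact Set.subset_iUnion (fun i => F.map i '' K) i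

theorem exists_word (hK : F.IsSelfSimilarSet K) (n : ℕ) {x : EuclideanSpace ℝ (Fin d)}
    (hx : x ∈ K) : ∃ u : List (Fin m), u.length = n ∧ x ∈ F.wordMap u '' K := by
  induction n generalizing x with
  | zero => exact ⟨[], rfl, x, hx, rfl⟩
  | succ n ih =>
    rw [hK.2.2] at hx
    obtain ⟨i, y, hy, rfl⟩ := Set.mem_iUnion.1 hx
    obtain ⟨u, hu, z, hz, rfl⟩ := ih hy
    exact ⟨i :: u, by simp [hu], z, hz, rfl⟩

/-- A cell of `K` containing `x` shrinks around `S_u(y)`, which lies in `J`, and `J` is closed. -/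
theorem subset_of_isInvariantSet {J : Set (EuclideanSpace ℝ (Fin d))}
    (hK : F.IsSelfSimilarSet K) (hJ : F.IsInvariantSet J) : K ⊆ J := by
  intro x hx
  obtain ⟨y, hy⟩ := hJ.1
  obtain ⟨D, hD⟩ := hK.2.1.isBounded.subset_closedBall y
  rw [← hJ.2.1.closure_eq, Metric.mem_closure_iff]
  intro ε hε
  have hlim : Filter.Tendsto (fun n : ℕ => F.ratio ^ n * D) Filter.atTop (nhds 0) := by
    simpa using (tendsto_pow_atTop_nhds_zero_of_lt_one F.ratio_pos.le F.ratio_lt_one).mul_const D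
  obtain ⟨n, hn⟩ := (hlim.eventually_lt_const hε).exists
  obtain ⟨u, rfl, z, hz, rfl⟩ := hK.exists_word n hx
  refine ⟨_, wordMap_mem hJ.2.2.2 u hy, lt_of_le_of_lt ?_ hn⟩
  rw [dist_wordMap]
  exact mul_le_mul_of_nonneg_left (hD hz) (pow_nonneg F.ratio_pos.le _)

end IsSelfSimilarSet

/-! ### Chains in the horizontal graph -/

section HorizontalGraph

variable {J : Set (EuclideanSpace ℝ (Fin d))} {u v : List (Fin m)}

theorem length_eq_of_reachable (h : (F.horizontalGraph J).Reachable u v) :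
    u.length = v.length := by
  obtain ⟨p⟩ := h
  induction p with
  | nil => rfl
  | cons h _ ih => exact h.1.trans ih

theorem dist_le_of_adj {x : EuclideanSpace ℝ (Fin d)} {D : ℝ} (hD : J ⊆ closedBall x D)
    (h : (F.horizontalGraph J).Adj u v) :
    dist (F.wordMap u x) (F.wordMap v x) ≤ 2 * D * F.ratio ^ u.length := by
  obtain ⟨hl, -, z, ⟨a, ha, rfl⟩, b, hb, hab⟩ := h
  have h1 := dist_triangle_right (F.wordMap u x) (F.wordMap v x) (F.wordMap u a)
  rw [dist_wordMap, ← hab, dist_wordMap, ← hl] at h1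
  have hp := pow_pos F.ratio_pos u.length
  have h2 := mul_le_mul_of_nonneg_left (hD ha) hp.le
  have h3 := mul_le_mul_of_nonneg_left (hD hb) hp.le
  rw [dist_comm a] at h2
  rw [dist_comm b] at h3
  linarith

theorem dist_le_of_walk {x : EuclideanSpace ℝ (Fin d)} {D : ℝ} (hD : J ⊆ closedBall x D)
    (p : (F.horizontalGraph J).Walk u v) :
    dist (F.wordMap u x) (F.wordMap v x) ≤ p.length * (2 * D * F.ratio ^ u.length) := by
  induction p with
  | nil => simp
  | cons h p ih =>
    rw [← h.1] at ih
    rw [SimpleGraph.Walk.length_cons, Nat.cast_succ, add_mul, one_mul, add_comm]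
    exact (dist_triangle _ _ _).trans (add_le_add (dist_le_of_adj hD h) ih)

/-- A path has distinct vertices, all in one component, and one edge fewer than vertices. -/
theorem exists_walk_length_lt {V : Type*} {G : SimpleGraph V} {N : ℕ}
    (hN : ∀ C : G.ConnectedComponent, C.supp.encard ≤ N) {u v : V} (h : G.Reachable u v) :
    ∃ p : G.Walk u v, p.length < N := by
  classical
  obtain ⟨p, hp⟩ := h.exists_isPath
  refine ⟨p, ?_⟩
  have hsub : (p.support.toFinset : Set V) ⊆ (G.connectedComponentMk u).supp := by
    intro w hw
    rw [SimpleGraph.ConnectedComponent.mem_supp_iff, SimpleGraph.ConnectedComponent.eq]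
    exact (p.takeUntil w (by simpa using hw)).reachable.symm
  have h1 := (Set.encard_le_encard hsub).trans (hN _)
  rw [Set.encard_coe_eq_coe_finsetCard, List.toFinset_card_of_nodup hp.support_nodup,
    SimpleGraph.Walk.length_support] at h1
  exact_mod_cast h1

end HorizontalGraph

/-! ### Bounded components force total disconnectedness -/

theorem isTotallyDisconnected_of_bounded {K J : Set (EuclideanSpace ℝ (Fin d))}
    (hK : F.IsSelfSimilarSet K) (hJ : F.IsInvariantSet J)
    {N : ℕ} (hN : ∀ C : (F.horizontalGraph J).ConnectedComponent, C.supp.encard ≤ N) :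
    IsTotallyDisconnected K := by
  intro A hAK hA x hx y hy
  obtain ⟨x₀, hx₀⟩ := hJ.1
  obtain ⟨D, hD⟩ := hJ.2.2.1.subset_closedBall x₀
  have hKJ := hK.subset_of_isInvariantSet hJ
  have hD0 : 0 ≤ D := dist_nonneg.trans (hD hx₀)
  -- One `D` for each end cell, and at most `N` chain steps of length `2 * D`, all scaled by `r ^
  -- n`.
  have key : ∀ n : ℕ, dist x y ≤ F.ratio ^ n * (2 * D + N * (2 * D)) := by
    intro n
    obtain ⟨u, hu, hxu⟩ := hK.exists_word n (hAK hx)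
    let W₁ : Set (List (Fin m)) := {v | v.length = n ∧ (F.horizontalGraph J).Reachable u v}
    let W₂ : Set (List (Fin m)) := {v | v.length = n ∧ ¬ (F.horizontalGraph J).Reachable u v}
    have hfin : {v : List (Fin m) | v.length = n}.Finite := List.finite_length_eq _ n
    have hclosed : ∀ W ⊆ {v : List (Fin m) | v.length = n},
        IsClosed (⋃ v ∈ W, F.wordMap v '' K) := fun W hW =>
      (hfin.subset hW).isClosed_biUnion fun v _ =>
        (hK.2.1.image (F.continuous_wordMap v)).isClosed
    have hcover : A ⊆ (⋃ v ∈ W₁, F.wordMap v '' K) ∪ ⋃ v ∈ W₂, F.wordMap v '' K := by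
      intro z hz
      obtain ⟨v, hv, hzv⟩ := hK.exists_word n (hAK hz)
      by_cases h : (F.horizontalGraph J).Reachable u v
      · exact Or.inl (Set.mem_biUnion (show v ∈ W₁ from ⟨hv, h⟩) hzv)
      · exact Or.inr (Set.mem_biUnion (show v ∈ W₂ from ⟨hv, h⟩) hzv)
    have hdisj : Disjoint (⋃ v ∈ W₁, F.wordMap v '' K) (⋃ v ∈ W₂, F.wordMap v '' K) := by
      rw [Set.disjoint_left]
      intro z hz₁ hz₂
      obtain ⟨v, hv, hzv⟩ := Set.mem_iUnion₂.1 hz₁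
      obtain ⟨w, hw, hzw⟩ := Set.mem_iUnion₂.1 hz₂
      refine hw.2 (hv.2.trans ?_)
      by_cases hvw : v = w
      · rw [hvw]
      · exact SimpleGraph.Adj.reachable ⟨hv.1.trans hw.1.symm, hvw, z,
          Set.image_mono hKJ hzv, Set.image_mono hKJ hzw⟩
    have hxW : x ∈ ⋃ v ∈ W₁, F.wordMap v '' K :=
      Set.mem_biUnion (show u ∈ W₁ from ⟨hu, SimpleGraph.Reachable.refl u⟩) hxu
    have hyW : y ∈ ⋃ v ∈ W₁, F.wordMap v '' K := by
      rcases (isPreconnected_iff_subset_of_disjoint_closed.1 hA) _ _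
        (hclosed W₁ fun _ h => h.1) (hclosed W₂ fun _ h => h.1) hcover
        (by rw [hdisj.inter_eq, Set.inter_empty]) with h | h
      · exact h hy
      · exact (Set.disjoint_left.1 hdisj hxW (h hx)).elim
    obtain ⟨v, hv, hyv⟩ := Set.mem_iUnion₂.1 hyW
    obtain ⟨a, ha, rfl⟩ := hxu
    obtain ⟨b, hb, rfl⟩ := hyv
    obtain ⟨p, hp⟩ := exists_walk_length_lt hN hv.2
    have h1 := dist_le_of_walk hD p
    have h2 := dist_triangle4 (F.wordMap u a) (F.wordMap u x₀) (F.wordMap v x₀) (F.wordMap v b)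
    rw [dist_wordMap, dist_wordMap, hu, hv.1] at h2
    rw [hu] at h1
    have hr := pow_pos F.ratio_pos n
    have h3 := mul_le_mul_of_nonneg_left (hD (hKJ ha)) hr.le
    have h4 := mul_le_mul_of_nonneg_left (hD (hKJ hb)) hr.le
    rw [dist_comm b] at h4
    have h5 : (p.length : ℝ) * (2 * D * F.ratio ^ n) ≤ N * (2 * D * F.ratio ^ n) :=
      mul_le_mul_of_nonneg_right (by exact_mod_cast hp.le) (by positivity)
    linarith
  have hlim : Filter.Tendsto (fun n : ℕ => F.ratio ^ n * (2 * D + N * (2 * D)))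
      Filter.atTop (nhds 0) := by
    simpa using (tendsto_pow_atTop_nhds_zero_of_lt_one F.ratio_pos.le F.ratio_lt_one).mul_const _
  exact dist_le_zero.1 (ge_of_tendsto' hlim key)

/-! ### Porosity and separation -/

/-- A compact set with empty interior misses a ball of uniform size in every ball of a given
radius. -/
theorem exists_uniform_hole {E : Type*} [MetricSpace E] [ProperSpace E] {K : Set E}
    (hK : IsCompact K) (hint : interior K = ∅) {ρ : ℝ} (hρ : 0 < ρ) :
    ∃ η > 0, ∀ x, ∃ y, ball y η ⊆ ball x ρ ∧ Disjoint (ball y η) K := by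
  have hc : IsCompact (cthickening ρ K) := hK.cthickening
  have : ∃ η > 0, ∀ x ∈ cthickening ρ K, ∃ y, ball y η ⊆ ball x ρ ∧ Disjoint (ball y η) K := by
    refine hc.induction_on (p := fun s => ∃ η > 0, ∀ x ∈ s, ∃ y, ball y η ⊆ ball x ρ ∧
      Disjoint (ball y η) K) ⟨1, one_pos, by simp⟩ ?_ ?_ ?_
    · rintro s t hst ⟨η, hη, h⟩
      exact ⟨η, hη, fun x hx => h x (hst hx)⟩
    · rintro s t ⟨η, hη, h⟩ ⟨θ, hθ, h'⟩
      refine ⟨min η θ, lt_min hη hθ, fun x hx => ?_⟩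
      rcases hx with hx | hx
      · obtain ⟨y, h1, h2⟩ := h x hx
        have hs := ball_subset_ball (x := y) (min_le_left η θ)
        exact ⟨y, hs.trans h1, h2.mono_left hs⟩
      · obtain ⟨y, h1, h2⟩ := h' x hx
        have hs := ball_subset_ball (x := y) (min_le_right η θ)
        exact ⟨y, hs.trans h1, h2.mono_left hs⟩
    · intro x _
      have hne : ¬ ball x (ρ / 2) ⊆ K := fun h => by
        have := interior_maximal h isOpen_ball (mem_ball_self (half_pos hρ))
        simp [hint] at this
      obtain ⟨y, hy, hyK⟩ := Set.not_subset.1 hne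
      obtain ⟨η, hη, hsub⟩ := Metric.isOpen_iff.1 (isOpen_ball.inter hK.isClosed.isOpen_compl)
        y ⟨hy, hyK⟩
      -- Halving the radius lets one hole near `x` serve every center within `ρ / 2`.
      refine ⟨ball x (ρ / 2), mem_nhdsWithin_of_mem_nhds (ball_mem_nhds x (half_pos hρ)), η, hη,
        fun z hz => ⟨y, fun w hw => ?_, ?_⟩⟩
      · have h1 := (hsub hw).1
        rw [mem_ball] at h1 hz ⊢
        have := dist_triangle_right w z x
        linarith
      · exact Set.disjoint_left.2 fun w hw => (hsub hw).2
  obtain ⟨η, hη, h⟩ := this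
  refine ⟨min η ρ, lt_min hη hρ, fun x => ?_⟩
  by_cases hx : x ∈ cthickening ρ K
  · obtain ⟨y, h1, h2⟩ := h x hx
    have hs := ball_subset_ball (x := y) (min_le_left η ρ)
    exact ⟨y, hs.trans h1, h2.mono_left hs⟩
  · refine ⟨x, ball_subset_ball (min_le_right _ _), Set.disjoint_left.2 fun w hw hwK => hx ?_⟩
    exact mem_cthickening_of_dist_le x w ρ K hwK
      (by rw [dist_comm]; exact (mem_ball.1 hw).le.trans (min_le_right _ _))

/-- Induction on the number of cells: pull the current hole back by `S_u`, find a uniform smaller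
hole off `K`, and push it forward. Since the pulled-back radius is always `δ`, the loss does not
depend on `j`. -/
theorem exists_hole_of_card_le {K : Set (EuclideanSpace ℝ (Fin d))}
    (hK : IsCompact K) (hint : interior K = ∅) (M : ℕ) :
    ∃ δ > 0, ∀ (j : ℕ) (W : Finset (List (Fin m))), W.card ≤ M → (∀ u ∈ W, u.length = j) →
      ∀ x, ∃ y, ball y (δ * F.ratio ^ j) ⊆ ball x (F.ratio ^ j) ∧
        ∀ u ∈ W, Disjoint (ball y (δ * F.ratio ^ j)) (F.wordMap u '' K) := by
  classical
  induction M with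
  | zero =>
    refine ⟨1, one_pos, fun j W hW _ x => ⟨x, by simp, fun u hu => ?_⟩⟩
    simp [Finset.card_eq_zero.1 (Nat.le_zero.1 hW)] at hu
  | succ M ih =>
    obtain ⟨δ, hδ, h⟩ := ih
    obtain ⟨η, hη, hhole⟩ := exists_uniform_hole hK hint hδ
    have hle : ∀ j, min η δ * F.ratio ^ j ≤ δ * F.ratio ^ j := fun j =>
      mul_le_mul_of_nonneg_right (min_le_right _ _) (pow_nonneg F.ratio_pos.le _)
    have hle' : ∀ j, min η δ * F.ratio ^ j ≤ η * F.ratio ^ j := fun j =>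
      mul_le_mul_of_nonneg_right (min_le_left _ _) (pow_nonneg F.ratio_pos.le _)
    refine ⟨min η δ, lt_min hη hδ, fun j W hW hlen x => ?_⟩
    rcases W.eq_empty_or_nonempty with rfl | ⟨u, hu⟩
    · obtain ⟨y, h1, -⟩ := h j ∅ (by simp) (by simp) x
      exact ⟨y, (ball_subset_ball (hle j)).trans h1, by simp⟩
    · obtain ⟨y, h1, h2⟩ := h j (W.erase u) (by rw [Finset.card_erase_of_mem hu]; omega)
        (fun v hv => hlen v (Finset.mem_of_mem_erase hv)) x
      obtain ⟨y, rfl⟩ := F.wordMap_surjective u y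
      obtain ⟨z, h3, h4⟩ := hhole y
      have h5 := F.ball_wordMap_subset (u := u) h3
      rw [hlen u hu] at h5
      have h6 := (ball_subset_ball (x := F.wordMap u z) (hle' j)).trans h5
      refine ⟨F.wordMap u z, h6.trans h1, fun v hv => ?_⟩
      by_cases hvu : v = u
      · subst hvu
        refine Disjoint.mono_left (ball_subset_ball (hle' j)) (Set.disjoint_left.2 ?_)
        rintro _ hw ⟨k, hk, rfl⟩
        rw [mem_ball, dist_wordMap, hlen v hu, mul_comm,
          mul_lt_mul_iff_left₀ (pow_pos F.ratio_pos j)] at hw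
        exact Set.disjoint_left.1 h4 hw hk
      · exact (h2 v (Finset.mem_erase.2 ⟨hvu, hv⟩)).mono_left h6

theorem disjoint_wordMap_image {U : Set (EuclideanSpace ℝ (Fin d))}
    (hU : ∀ i, F.map i '' U ⊆ U)
    (hdisj : Pairwise fun i j => Disjoint (F.map i '' U) (F.map j '' U))
    {u v : List (Fin m)} (hl : u.length = v.length) (hne : u ≠ v) :
    Disjoint (F.wordMap u '' U) (F.wordMap v '' U) := by
  induction u generalizing v with
  | nil => exact (hne (List.length_eq_zero_iff.1 hl.symm).symm).elim
  | cons i u ih =>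
    cases v with
    | nil => simp at hl
    | cons j v =>
      rw [Set.disjoint_left]
      rintro _ ⟨a, ha, rfl⟩ ⟨b, hb, hab⟩
      by_cases hij : i = j
      · subst hij
        have hinj : F.wordMap v b = F.wordMap u a := by
          rw [← dist_eq_zero]
          have h := F.dist_wordMap [i] (F.wordMap v b) (F.wordMap u a)
          rw [show F.wordMap [i] (F.wordMap v b) = F.wordMap [i] (F.wordMap u a) from hab,
            dist_self] at h
          exact (mul_eq_zero.1 h.symm).resolve_left (pow_pos F.ratio_pos _).ne'
        exact Set.disjoint_left.1 (ih (by simpa using hl) (by simpa using hne))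
          ⟨a, ha, rfl⟩ ⟨b, hb, hinj⟩
      · exact Set.disjoint_left.1 (hdisj hij) ⟨_, wordMap_mem hU u ha, rfl⟩
          ⟨_, wordMap_mem hU v hb, hab⟩

/-- Under the open set condition, the images of a point of the open set under the words of a given
length are uniformly separated. -/
theorem OpenSetCondition.exists_separated (h : F.OpenSetCondition) :
    ∃ x, ∃ c > 0, ∀ u v : List (Fin m), u.length = v.length → u ≠ v →
      c * F.ratio ^ u.length ≤ dist (F.wordMap u x) (F.wordMap v x) := by
  obtain ⟨U, ⟨x, hx⟩, hopen, -, hU, hdisj⟩ := h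
  obtain ⟨c, hc, hball⟩ := Metric.isOpen_iff.1 hopen x hx
  refine ⟨x, c, hc, fun u v hl hne => le_of_not_gt fun hlt => ?_⟩
  obtain ⟨y, hy⟩ := F.wordMap_surjective u (F.wordMap v x)
  refine Set.disjoint_left.1 (disjoint_wordMap_image hU hdisj hl hne) ⟨y, hball ?_, hy⟩ ⟨x, hx, rfl⟩
  rw [← hy, dist_wordMap, mul_comm, mul_lt_mul_iff_left₀ (pow_pos F.ratio_pos _)] at hlt
  rwa [mem_ball, dist_comm]

/-! ### The one-dimensional converse -/

section Line

variable {F : SimilarIFS 1 m}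

theorem dist_eq_abs_coord (x y : EuclideanSpace ℝ (Fin 1)) : dist x y = |x 0 - y 0| := by
  rw [EuclideanSpace.dist_eq]
  simp [Real.dist_eq, Real.sqrt_sq_eq_abs]

theorem OpenSetCondition.exists_card_le (h : F.OpenSetCondition) (k : EuclideanSpace ℝ (Fin 1))
    (A : ℝ) :
    ∃ N : ℕ, ∀ (n : ℕ) (z : EuclideanSpace ℝ (Fin 1)) (W : Set (List (Fin m))),
      (∀ u ∈ W, u.length = n ∧ dist (F.wordMap u k) z ≤ A * F.ratio ^ n) → W.encard ≤ N := by
  obtain ⟨x, c, hc, hsep⟩ := h.exists_separated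
  obtain ⟨B, hB⟩ := exists_nat_ge ((A + dist x k) / c)
  refine ⟨(Finset.Icc (-(B : ℤ) - 1) B).card, fun n z W hW => ?_⟩
  have hr := pow_pos F.ratio_pos n
  have hcr : 0 < c * F.ratio ^ n := mul_pos hc hr
  -- Separated points fall into different intervals of length `c * r ^ n`, so counting words becomes
  -- counting integers.
  let f : List (Fin m) → ℤ := fun u => ⌊(F.wordMap u x 0 - z 0) / (c * F.ratio ^ n)⌋
  have hinj : Set.InjOn f W := by
    intro u hu v hv huv
    by_contra hne
    have h1 := hsep u v ((hW u hu).1.trans (hW v hv).1.symm) hne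
    rw [(hW u hu).1, dist_eq_abs_coord] at h1
    have h2 := Int.abs_sub_lt_one_of_floor_eq_floor huv
    rw [← sub_div, abs_div, abs_of_pos hcr, div_lt_one hcr, sub_sub_sub_cancel_right] at h2
    exact absurd h1 (not_le.2 h2)
  have hmaps : f '' W ⊆ (Finset.Icc (-(B : ℤ) - 1) B : Finset ℤ) := by
    rintro _ ⟨u, hu, rfl⟩
    obtain ⟨hl, hd⟩ := hW u hu
    have h1 := dist_triangle (F.wordMap u x) (F.wordMap u k) z
    rw [dist_wordMap, hl, dist_eq_abs_coord (F.wordMap u x) z] at h1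
    have h2 : |F.wordMap u x 0 - z 0| ≤ B * (c * F.ratio ^ n) := by
      rw [div_le_iff₀ hc] at hB
      have := mul_le_mul_of_nonneg_right hB hr.le
      linarith
    have h3 : |(F.wordMap u x 0 - z 0) / (c * F.ratio ^ n)| ≤ B := by
      rwa [abs_div, abs_of_pos hcr, div_le_iff₀ hcr]
    rw [abs_le] at h3
    rw [Finset.coe_Icc, Set.mem_Icc]
    constructor
    · refine Int.le_floor.2 ?_
      push_cast
      linarith
    · exact (Int.cast_le (R := ℝ)).1 (by push_cast; exact (Int.floor_le _).trans h3.2)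
  rw [← hinj.encard_image, ← Set.encard_coe_eq_coe_finsetCard]
  exact Set.encard_le_encard hmaps

theorem interior_eq_empty_of_isTotallyDisconnected {K : Set (EuclideanSpace ℝ (Fin 1))}
    (h : IsTotallyDisconnected K) : interior K = ∅ := by
  rw [Set.eq_empty_iff_forall_notMem]
  intro x hx
  obtain ⟨ε, hε, hsub⟩ := Metric.isOpen_iff.1 isOpen_interior x hx
  have hss := h _ (hsub.trans interior_subset) (convex_ball x ε).isPreconnected
  let y : EuclideanSpace ℝ (Fin 1) := WithLp.toLp 2 fun _ => x 0 + ε / 2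
  have hy : y ∈ ball x ε := by
    rw [mem_ball, dist_eq_abs_coord]
    simp only [y, add_sub_cancel_left, abs_of_pos (half_pos hε)]
    linarith
  have h0 := congrArg (fun z : EuclideanSpace ℝ (Fin 1) => z 0) (hss hy (mem_ball_self hε))
  simp only [y] at h0
  linarith

theorem OpenSetCondition.exists_hole {K : Set (EuclideanSpace ℝ (Fin 1))}
    (h : F.OpenSetCondition) (hK : F.IsSelfSimilarSet K) (hint : interior K = ∅) :
    ∃ δ > 0, ∀ (j : ℕ) x, ∃ y, ball y (δ * F.ratio ^ j) ⊆ ball x (F.ratio ^ j) ∧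
      Disjoint (ball y (δ * F.ratio ^ j)) K := by
  obtain ⟨k, hk⟩ := hK.1
  obtain ⟨D, hD⟩ := hK.2.1.isBounded.subset_closedBall k
  obtain ⟨M, hM⟩ := h.exists_card_le k (D + 1)
  obtain ⟨δ, hδ, hhole⟩ := exists_hole_of_card_le (F := F) hK.2.1 hint M
  refine ⟨δ, hδ, fun j x => ?_⟩
  -- Cells have radius at most `D * r ^ j` about their base points, so only words in `W` can meet
  -- the ball of radius `r ^ j` about `x`.
  let W : Set (List (Fin m)) :=
    {u | u.length = j ∧ dist (F.wordMap u k) x ≤ (D + 1) * F.ratio ^ j}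
  have hWM : W.encard ≤ M := hM j x W fun u hu => hu
  have hWf : W.Finite := (List.finite_length_eq _ j).subset fun _ hu => hu.1
  obtain ⟨y, h1, h2⟩ := hhole j hWf.toFinset
    (by rw [hWf.encard_eq_coe_toFinset_card] at hWM; exact_mod_cast hWM)
    (fun u hu => (hWf.mem_toFinset.1 hu).1) x
  refine ⟨y, h1, Set.disjoint_left.2 fun z hz hzK => ?_⟩
  obtain ⟨u, hu, hzu⟩ := hK.exists_word j hzK
  refine Set.disjoint_left.1 (h2 u (hWf.mem_toFinset.2 ⟨hu, ?_⟩)) hz hzu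
  have hzx := mem_ball.1 (h1 hz)
  obtain ⟨a, ha, rfl⟩ := hzu
  have h3 := dist_triangle_left (F.wordMap u k) x (F.wordMap u a)
  rw [dist_wordMap, hu] at h3
  have h4 := mul_le_mul_of_nonneg_left (hD ha) (pow_pos F.ratio_pos j).le
  linarith

/-- A chain of words cannot cross a hole of the self-similar set that is longer than its steps. -/
theorem coord_lt_of_reachable {K J : Set (EuclideanSpace ℝ (Fin 1))}
    (hK : F.IsSelfSimilarSet K) {k y : EuclideanSpace ℝ (Fin 1)} (hk : k ∈ K) {D δ : ℝ} {n : ℕ}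
    (hD : J ⊆ closedBall k D) (hδ : D * F.ratio ^ n < δ) (hy : Disjoint (ball y δ) K)
    {u v : List (Fin m)} (hu : u.length = n) (h : (F.horizontalGraph J).Reachable u v)
    (hlt : F.wordMap u k 0 < y 0) : F.wordMap v k 0 < y 0 := by
  obtain ⟨p⟩ := h
  induction p with
  | nil => exact hlt
  | @cons u v w hadj p ih =>
    refine ih (hadj.1.symm.trans hu) (lt_of_not_ge fun hge => ?_)
    have h1 := dist_le_of_adj hD hadj
    have hout : ∀ w : List (Fin m), δ ≤ |F.wordMap w k 0 - y 0| := fun w => by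
      rw [← dist_eq_abs_coord]
      exact le_of_not_gt fun hw =>
        Set.disjoint_left.1 hy (mem_ball.2 hw) (wordMap_mem hK.map_subset w hk)
    have h2 := hout u
    have h3 := hout v
    rw [abs_of_neg (by linarith)] at h2
    rw [abs_of_nonneg (by linarith)] at h3
    rw [dist_eq_abs_coord, abs_of_nonpos (by linarith), hu] at h1
    linarith

theorem bounded_of_isTotallyDisconnected {K J : Set (EuclideanSpace ℝ (Fin 1))}
    (hK : F.IsSelfSimilarSet K) (hJ : F.IsInvariantSet J) (hosc : F.OpenSetCondition)
    (htd : IsTotallyDisconnected K) :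
    ∃ N : ℕ, ∀ C : (F.horizontalGraph J).ConnectedComponent, C.supp.encard ≤ N := by
  obtain ⟨k, hk⟩ := hK.1
  have hKJ := hK.subset_of_isInvariantSet hJ
  obtain ⟨D, hD⟩ := hJ.2.2.1.subset_closedBall k
  have hD0 : 0 ≤ D := dist_nonneg.trans (hD (hKJ hk))
  obtain ⟨δ, hδ, hhole⟩ :=
    hosc.exists_hole hK (interior_eq_empty_of_isTotallyDisconnected htd)
  have hlim : Filter.Tendsto (fun n : ℕ => D * F.ratio ^ n) Filter.atTop (nhds 0) := by
    simpa using (tendsto_pow_atTop_nhds_zero_of_lt_one F.ratio_pos.le F.ratio_lt_one).const_mul D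
  obtain ⟨p, hp⟩ := (hlim.eventually_lt_const hδ).exists
  have hrp := pow_pos F.ratio_pos p
  -- Points of one component cannot lie on different sides of a hole, hence are close together.
  have hclose : ∀ u v : List (Fin m), (F.horizontalGraph J).Reachable u v → p ≤ u.length →
      F.wordMap v k 0 - F.wordMap u k 0 ≤ 2 * F.ratio ^ (u.length - p) := by
    intro u v huv hpu
    by_contra! hlt
    have hpow : F.ratio ^ u.length = F.ratio ^ p * F.ratio ^ (u.length - p) := by
      rw [← pow_add, Nat.add_sub_cancel' hpu]
    have hr := pow_pos F.ratio_pos (u.length - p)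
    -- The hole's center is within `r ^ (n - p)` of the midpoint (`n` the level), less than half the
    -- gap, so it separates the two points.
    obtain ⟨y, h1, h2⟩ := hhole (u.length - p)
      (WithLp.toLp 2 fun _ => (F.wordMap u k 0 + F.wordMap v k 0) / 2)
    have h3 := mem_ball.1 (h1 (mem_ball_self (mul_pos hδ hr)))
    rw [dist_eq_abs_coord, abs_lt] at h3
    simp only at h3
    have h4 := coord_lt_of_reachable hK hk hD
      (by rw [hpow, ← mul_assoc]; exact mul_lt_mul_of_pos_right hp hr) h2 rfl huv (by linarith)
    linarith
  -- The summand 2 with the factor `r ^ (-p)` comes from `hclose`; `2 * D` covers the levels below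
  -- `p`, where only the diameter bound is available.
  obtain ⟨N, hN⟩ := hosc.exists_card_le k ((2 * D + 2) * (F.ratio ^ p)⁻¹)
  refine ⟨N, fun C => ?_⟩
  induction C using SimpleGraph.ConnectedComponent.ind with
  | _ u =>
    refine hN u.length (F.wordMap u k) _ fun v hv => ?_
    rw [SimpleGraph.ConnectedComponent.mem_supp_iff, SimpleGraph.ConnectedComponent.eq] at hv
    have hl := length_eq_of_reachable hv
    refine ⟨hl, ?_⟩
    rcases le_or_gt p u.length with hpu | hpu
    · have hpow : F.ratio ^ u.length = F.ratio ^ p * F.ratio ^ (u.length - p) := by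
        rw [← pow_add, Nat.add_sub_cancel' hpu]
      have h1 := hclose u v hv.symm hpu
      have h2 := hclose v u hv (hl ▸ hpu)
      rw [hl] at h2
      rw [hpow, mul_assoc, inv_mul_cancel_left₀ hrp.ne', dist_eq_abs_coord, abs_le]
      have h3 := mul_nonneg hD0 (pow_pos F.ratio_pos (u.length - p)).le
      constructor <;> linarith
    · have h1 : dist (F.wordMap v k) k ≤ D := hD (hKJ (wordMap_mem hK.map_subset v hk))
      have h2 : dist (F.wordMap u k) k ≤ D := hD (hKJ (wordMap_mem hK.map_subset u hk))
      have h3 : F.ratio ^ p ≤ F.ratio ^ u.length :=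
        pow_le_pow_of_le_one F.ratio_pos.le F.ratio_lt_one.le hpu.le
      have h4 : 1 ≤ (F.ratio ^ p)⁻¹ * F.ratio ^ u.length := by
        rwa [inv_mul_eq_div, one_le_div hrp]
      rw [mul_assoc]
      calc dist (F.wordMap v k) (F.wordMap u k) ≤ (2 * D + 2) * 1 := by
            linarith [dist_triangle_right (F.wordMap v k) (F.wordMap u k) k]
        _ ≤ _ := mul_le_mul_of_nonneg_left h4 (by linarith)

end Line

end SimilarIFS

theorem mainTheorem9 {d m : ℕ} (F : SimilarIFS d m) (K J : Set (EuclideanSpace ℝ (Fin d)))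
    (hK : F.IsSelfSimilarSet K) (hJ : F.IsInvariantSet J) :
    (F.BoundedHorizontalComponents J → IsTotallyDisconnected K) ∧
      (d = 1 → F.OpenSetCondition → IsTotallyDisconnected K →
        F.BoundedHorizontalComponents J) := by
  rw [SimilarIFS.BoundedHorizontalComponents, F.horizontalPart_augmentedTree J]
  refine ⟨fun ⟨N, hN⟩ => SimilarIFS.isTotallyDisconnected_of_bounded hK hJ hN, ?_⟩
  rintro rfl hosc htd
  exact SimilarIFS.bounded_of_isTotallyDisconnected hK hJ hosc htd
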